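/- Theorem. All Banach spaces are real, and a compact space is a compact Hausdorff space. A compact space $K$ is monolithic if every separable subspace of $K$ is second countable. It has Property (M) if for every regular signed finite Borel measure $\mu$ on $K$ the support $\operatorname{supp}\mu=\{p\in K : |\mu|(U)>0 \text{ for every open neighborhood } U \text{ of } p\}$ is separable, where $|\mu|$ is the total variation of $\mu$. A Banach space $X$ has the $2$-$c_0$-extension property if every bounded operator $T:Y\to c_0$ defined on a closed subspace $Y$ of $X$ admits a bounded extension $\tilde T:X\to c_0$ with $\|\tilde T\|\le 2\|T\|$. Let $C(K)$ be the Banach space of real-valued continuous functions on $K$ with the supremum norm. If $K$ is a monolithic compact space with Property (M), then $C(K)$ has the $2$-$c_0$-extension property. Consequently, if $K$ is a monolithic compact space belonging to any of the following classes, then $C(K)$ has the $2$-$c_0$-extension property: (a) compact lines, i.e. totally ordered sets that are compact in the order topology; (b) scattered spaces, i.e. spaces in which every closed subspace $Y$ has a dense set of isolated points of $Y$; (c) Rosenthal compacta, i.e. spaces homeomorphic to a compact subset, in the topology of pointwise convergence, of the space of real-valued Baire class one functions (pointwise limits of sequences of continuous functions) on a Polish space. -/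

import Mathlib

open Filter Topology MeasureTheory
open scoped ZeroAtInfty

universe u v

/-- The `c₀`-extension property with constant `lam` (meant for a real Banach space `X` and
`1 ≤ lam`): every bounded operator `T : Y → c₀` on a closed subspace `Y` of `X` admits a bounded
extension `T' : X → c₀` with `‖T'‖ ≤ lam * ‖T‖`. Here `c₀` is `C₀(ℕ, ℝ)`, the real sequences
tending to zero, with the supremum norm. -/
def HasC0ExtensionProperty (lam : ℝ) (X : Type u) [NormedAddCommGroup X] [NormedSpace ℝ X] :
    Prop :=
  ∀ Y : Submodule ℝ X, IsClosed (Y : Set X) → ∀ T : Y →L[ℝ] C₀(ℕ, ℝ),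
    ∃ T' : X →L[ℝ] C₀(ℕ, ℝ), (∀ y : Y, T' (y : X) = T y) ∧ ‖T'‖ ≤ lam * ‖T‖

/-- A space is monolithic if each of its separable subspaces is second countable. -/
def IsMonolithic (K : Type u) [TopologicalSpace K] : Prop :=
  ∀ S : Set K, TopologicalSpace.SeparableSpace S → SecondCountableTopology S

/-- Property (M): every regular signed finite Borel measure has a separable support, where the
support is that of the total variation. -/
def HasPropertyM (K : Type u) [TopologicalSpace K] [MeasurableSpace K] [BorelSpace K] : Prop :=
  ∀ μ : SignedMeasure K, μ.totalVariation.Regular →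
    TopologicalSpace.SeparableSpace μ.totalVariation.support

/-- A space is scattered if in each closed subspace the isolated points are dense. -/
def IsScatteredSpace (K : Type u) [TopologicalSpace K] : Prop :=
  ∀ Y : Set K, IsClosed Y → Dense {y : Y | IsOpen ({y} : Set Y)}

/-- A real function is of Baire class one if it is the pointwise limit of a sequence of continuous
functions. -/
def IsBaireClassOne {P : Type v} [TopologicalSpace P] (f : P → ℝ) : Prop :=
  ∃ g : ℕ → C(P, ℝ), ∀ x, Tendsto (fun n => g n x) atTop (𝓝 (f x))

/-- A Rosenthal compactum is a space homeomorphic to a compact set of Baire class one functions on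
a Polish space, with the topology of pointwise convergence. -/
def IsRosenthalCompactum (K : Type u) [TopologicalSpace K] : Prop :=
  ∃ (P : Type v) (_ : TopologicalSpace P) (_ : PolishSpace P) (S : Set (P → ℝ)),
    IsCompact S ∧ (∀ f ∈ S, IsBaireClassOne f) ∧ Nonempty (K ≃ₜ S)

/-! By Hahn–Banach the coordinates of `T` extend to functionals `ψ n` of norm at most `‖T‖`, but
these need not tend to zero off `Y`. Their weak* cluster points vanish on `Y`, so one subtracts
functionals `θ n` in the same ball that vanish on `Y` and are asymptotic to `ψ n`; this costs the
factor 2. Asymptotics can be arranged on countably many vectors only. That is enough if all `ψ n`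
live on one separable closed set `S`: by monolithicity `S` is compact metrizable, so `C(S)` is
separable.

By Riesz each functional is dominated by a finite regular measure, so everything reduces to
`RegularMeasuresSeparablyCarried`. Under Property (M) the support serves; on a scattered space, the
atoms; on a compact line, the quantiles of the distribution function.

For Rosenthal compacta, bump functions are parametrized in a Baire class one way by Polish spaces.
If no countable set met the supports of all bumps large in measure, there would be two countable
sets of parameters, accumulating at each other, whose bumps stay far apart in measure. But at each
point of `K` the dependence on the parameter has small oscillation somewhere on every set of
parameters, and a Cantor–Bendixson argument for random closed sets
(`exists_isOpen_measure_le_of_scattered`) makes this uniform in measure, a contradiction. -/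

/-! ### Veech's proof of Sobczyk's theorem -/

/-- Veech's approximation: a bounded sequence of functionals tending to zero pointwise on `Z` is
asymptotic, along any prescribed sequence of vectors, to a sequence of functionals in the same ball
vanishing on `Z`. -/
theorem exists_functionals_vanishing_asymptotic {X : Type*} [NormedAddCommGroup X]
    [NormedSpace ℝ X] {C : ℝ} (hC : 0 ≤ C) (ψ : ℕ → StrongDual ℝ X) (hψ : ∀ n, ‖ψ n‖ ≤ C)
    (Z : Set X) (hZ : ∀ z ∈ Z, Tendsto (fun n => ψ n z) atTop (𝓝 0)) (g : ℕ → X) :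
    ∃ θ : ℕ → StrongDual ℝ X, (∀ n, ‖θ n‖ ≤ C) ∧ (∀ n, ∀ z ∈ Z, θ n z = 0) ∧
      ∀ k, Tendsto (fun n => (ψ n - θ n) (g k)) atTop (𝓝 0) := by
  let P : ℕ → ℕ → Prop := fun m n => ∃ θ : StrongDual ℝ X, ‖θ‖ ≤ C ∧ (∀ z ∈ Z, θ z = 0) ∧
    ∀ k < m, |(ψ n - θ) (g k)| < 1 / ((m : ℝ) + 1)
  have hP0 : ∀ n, P 0 n := fun n => ⟨0, by simpa using hC, by simp, by simp⟩
  have hP : ∀ m, ∀ᶠ n in atTop, P m n := by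
    intro m
    -- Testing on ultrafilters allows the use of Banach–Alaoglu without metrizability of the dual
    -- ball.
    rw [eventually_iff, mem_iff_ultrafilter]
    intro U hU
    have hcpt := WeakDual.isCompact_closedBall (𝕜 := ℝ) (0 : StrongDual ℝ X) C
    obtain ⟨θ, hθ, hlim⟩ := hcpt.ultrafilter_le_nhds
      (U.map fun n => StrongDual.toWeakDual (ψ n)) (by
        rw [le_principal_iff]
        exact Filter.Eventually.of_forall (f := (U : Filter ℕ)) fun n => by simpa using hψ n)
    have hev : ∀ f : X, Tendsto (fun n => ψ n f) U (𝓝 (θ f)) := fun f =>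
      ((WeakDual.eval_continuous f).tendsto θ).comp hlim
    have hθ' : ‖WeakDual.toStrongDual θ‖ ≤ C := by simpa using hθ
    have hk : ∀ k, ∀ᶠ n in (U : Filter ℕ), |ψ n (g k) - θ (g k)| < 1 / ((m : ℝ) + 1) := by
      intro k
      have := (Metric.tendsto_nhds.1 (hev (g k))) (1 / ((m : ℝ) + 1)) (by positivity)
      simpa [Real.dist_eq] using this
    have hall : ∀ᶠ n in (U : Filter ℕ), ∀ k ∈ Finset.range m,
        |ψ n (g k) - θ (g k)| < 1 / ((m : ℝ) + 1) :=
      (Filter.eventually_all_finset _).2 fun k _ => hk k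
    filter_upwards [hall] with n hn
    refine ⟨WeakDual.toStrongDual θ, hθ', fun z hz => ?_, fun k hkm => ?_⟩
    · exact tendsto_nhds_unique (hev z) ((hZ z hz).mono_left hU)
    · exact hn k (Finset.mem_range.2 hkm)
  classical
  -- Diagonal choice: the best precision available at time `n`, capped by `n`. It tends to infinity,
  -- and `P 0 n` makes it well defined.
  let M : ℕ → ℕ := fun n => Nat.findGreatest (fun m => P m n) n
  have hM : ∀ n, P (M n) n := fun n => Nat.findGreatest_spec (P := fun m => P m n)
    (Nat.zero_le n) (hP0 n)
  have hMt : ∀ m, ∀ᶠ n in atTop, m ≤ M n := by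
    intro m
    filter_upwards [hP m, eventually_ge_atTop m] with n hn hmn
    exact Nat.le_findGreatest hmn hn
  choose θ hθC hθZ hθ using hM
  refine ⟨θ, hθC, hθZ, fun k => ?_⟩
  rw [Metric.tendsto_nhds]
  intro ε hε
  obtain ⟨N, hN⟩ := exists_nat_one_div_lt hε
  filter_upwards [hMt (max N (k + 1))] with n hn
  have h1 := hθ n k (lt_of_lt_of_le (Nat.lt_succ_self k) ((le_max_right _ _).trans hn))
  rw [Real.dist_eq, sub_zero]
  refine h1.trans (lt_of_le_of_lt ?_ hN)
  have : (N : ℝ) ≤ M n := by exact_mod_cast (le_max_left _ _).trans hn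
  gcongr

/-- A sequence of functionals that is bounded and tends pointwise to zero is an operator into
`c₀`. -/
theorem exists_operator_c0 {X : Type*} [NormedAddCommGroup X] [NormedSpace ℝ X] {C : ℝ}
    (hC : 0 ≤ C) (φ : ℕ → StrongDual ℝ X) (hφ : ∀ n, ‖φ n‖ ≤ C)
    (h0 : ∀ f, Tendsto (fun n => φ n f) atTop (𝓝 0)) :
    ∃ T : X →L[ℝ] C₀(ℕ, ℝ), (∀ f n, T f n = φ n f) ∧ ‖T‖ ≤ C := by
  let L : X →ₗ[ℝ] C₀(ℕ, ℝ) :=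
    { toFun := fun f => ⟨⟨fun n => φ n f, continuous_of_discreteTopology⟩, by
        simpa [Nat.cofinite_eq_atTop] using h0 f⟩
      map_add' := fun f g => by ext n; simp
      map_smul' := fun c f => by ext n; simp }
  have hL : ∀ f, ‖L f‖ ≤ C * ‖f‖ := by
    intro f
    rw [← ZeroAtInftyContinuousMap.norm_toBCF_eq_norm,
      BoundedContinuousFunction.norm_le (by positivity)]
    intro n
    exact (φ n).le_of_opNorm_le (hφ n) f
  exact ⟨L.mkContinuous C hL, fun f n => rfl, L.mkContinuous_norm_le hC hL⟩

/-- The coordinate functionals of `c₀`. -/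
noncomputable def c0Coord (n : ℕ) : C₀(ℕ, ℝ) →L[ℝ] ℝ :=
  LinearMap.mkContinuous
    { toFun := fun x => x n
      map_add' := fun _ _ => rfl
      map_smul' := fun _ _ => rfl } 1 fun x => by
    rw [one_mul, ← ZeroAtInftyContinuousMap.norm_toBCF_eq_norm]
    exact x.toBCF.norm_coe_le_norm n

@[simp] theorem c0Coord_apply (n : ℕ) (x : C₀(ℕ, ℝ)) : c0Coord n x = x n := rfl

theorem norm_c0Coord_le (n : ℕ) : ‖c0Coord n‖ ≤ 1 :=
  LinearMap.mkContinuous_norm_le _ zero_le_one _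

/-- A functional on `C(K)` that vanishes on the functions vanishing on `S` is bounded by the
supremum over `S`. -/
theorem functional_le_of_bound_on {K : Type*} [TopologicalSpace K] [CompactSpace K] {S : Set K}
    {φ : StrongDual ℝ C(K, ℝ)} {C : ℝ} (hφ : ‖φ‖ ≤ C)
    (hS : ∀ f : C(K, ℝ), (∀ x ∈ S, f x = 0) → φ f = 0) {f : C(K, ℝ)} {c : ℝ} (hc : 0 ≤ c)
    (hf : ∀ x ∈ S, |f x| ≤ c) : |φ f| ≤ C * c := by
  -- Truncating at height `c` does not change `f` on `S`, so it does not change `φ f`.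
  let f' : C(K, ℝ) := ⟨fun x => max (-c) (min c (f x)), by fun_prop⟩
  have h1 : φ (f - f') = 0 := hS _ fun x hx => by
    have := abs_le.1 (hf x hx)
    simp [f', this.1, this.2]
  have h2 : ‖f'‖ ≤ c := by
    rw [ContinuousMap.norm_le _ hc]
    intro x
    rw [Real.norm_eq_abs, abs_le]
    exact ⟨le_max_left _ _, max_le (by linarith) (min_le_left _ _)⟩
  rw [map_sub, sub_eq_zero] at h1
  rw [h1, ← Real.norm_eq_abs]
  exact φ.le_of_opNorm_le_of_le hφ h2

theorem separableSpace_closure_of_countable {K : Type*} [TopologicalSpace K] {D : Set K}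
    (hD : D.Countable) : TopologicalSpace.SeparableSpace (closure D) := by
  refine ⟨⟨Subtype.val ⁻¹' D, hD.preimage Subtype.val_injective, ?_⟩⟩
  rw [Subtype.dense_iff, Subtype.image_preimage_coe, Set.inter_eq_right.2 subset_closure]

/-- Veech's proof of Sobczyk's theorem for monolithic spaces on which each functional is carried
by a separable closed set. -/
theorem IsMonolithic.hasC0ExtensionProperty_of_functionals {K : Type u} [TopologicalSpace K]
    [CompactSpace K] [T2Space K] (hK : IsMonolithic K)
    (hc : ∀ φ : StrongDual ℝ C(K, ℝ), ∃ D : Set K, D.Countable ∧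
      ∀ f : C(K, ℝ), (∀ x ∈ closure D, f x = 0) → φ f = 0) :
    HasC0ExtensionProperty 2 C(K, ℝ) := by
  intro Y _ T
  have hext : ∀ n, ∃ ψ : StrongDual ℝ C(K, ℝ), (∀ y : Y, ψ y = T y n) ∧ ‖ψ‖ ≤ ‖T‖ := by
    intro n
    obtain ⟨ψ, h1, h2⟩ := exists_extension_norm_eq Y ((c0Coord n).comp T)
    refine ⟨ψ, h1, h2.le.trans (((c0Coord n).opNorm_comp_le T).trans ?_)⟩
    exact mul_le_of_le_one_left (norm_nonneg _) (norm_c0Coord_le n)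
  choose ψ hψY hψT using hext
  choose D hDc hD using fun n => hc (ψ n)
  let S : Set K := closure (⋃ n, D n)
  have hSsep : TopologicalSpace.SeparableSpace S :=
    separableSpace_closure_of_countable (Set.countable_iUnion hDc)
  have hSsc : SecondCountableTopology S := hK S hSsep
  have hScpt : CompactSpace S := isCompact_iff_compactSpace.1 isClosed_closure.isCompact
  let R : C(K, ℝ) → C(S, ℝ) := fun f => f.restrict S
  -- `C(S)` is separable because `S` is compact and second countable. Density within the range of
  -- restriction suffices, so no Tietze extension is needed.
  obtain ⟨G, hG⟩ : ∃ g : ℕ → C(K, ℝ), ∀ f : C(K, ℝ), ∀ δ > 0, ∃ k, ∀ x ∈ S, |(f - g k) x| ≤ δ := by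
    obtain ⟨c, hcc, hcd⟩ := TopologicalSpace.exists_countable_dense (Set.range R)
    have hne : c.Nonempty := by
      have : Nonempty (Set.range R) := ⟨⟨R 0, 0, rfl⟩⟩
      exact hcd.nonempty
    obtain ⟨e, rfl⟩ := hcc.exists_eq_range hne
    choose g hg using fun k => (e k).2
    refine ⟨g, fun f δ hδ => ?_⟩
    obtain ⟨_, ⟨k, rfl⟩, hk⟩ := Metric.dense_iff.1 hcd ⟨R f, f, rfl⟩ δ hδ |>.imp fun _ h => h.symm
    refine ⟨k, fun x hx => ?_⟩
    have h1 : dist (R (g k)) (R f) < δ := by rw [hg k]; exact hk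
    have h2 := (ContinuousMap.dist_apply_le_dist (f := R (g k)) (g := R f) ⟨x, hx⟩).trans h1.le
    rw [dist_comm, Real.dist_eq] at h2
    exact h2
  have hψS : ∀ n, ∀ f : C(K, ℝ), (∀ x ∈ S, f x = 0) → ψ n f = 0 := fun n f hf =>
    hD n f fun x hx => hf x (closure_mono (Set.subset_iUnion D n) hx)
  -- Vanishing on `Y` keeps the values of `T`; vanishing on functions null on `S` keeps `ψ n - θ n`
  -- carried by `S`.
  obtain ⟨θ, hθT, hθZ, hθ⟩ := exists_functionals_vanishing_asymptotic (norm_nonneg T) ψ hψT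
    ((Y : Set C(K, ℝ)) ∪ {f | ∀ x ∈ S, f x = 0}) (by
      rintro z (hz | hz)
      · have h := (T ⟨z, hz⟩).zero_at_infty'
        rw [cocompact_eq_cofinite, Nat.cofinite_eq_atTop] at h
        exact h.congr fun n => (hψY n ⟨z, hz⟩).symm
      · exact tendsto_const_nhds.congr fun n => (hψS n z hz).symm) G
  have hnorm : ∀ n, ‖ψ n - θ n‖ ≤ 2 * ‖T‖ := fun n =>
    (norm_sub_le (ψ n) (θ n)).trans (by linarith [hψT n, hθT n])
  have hlim : ∀ f, Tendsto (fun n => (ψ n - θ n) f) atTop (𝓝 0) := by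
    intro f
    rw [Metric.tendsto_nhds]
    intro ε hε
    -- The `+ 1` covers the case `T = 0`.
    obtain ⟨k, hk⟩ := hG f (ε / (2 * (2 * ‖T‖ + 1))) (by positivity)
    filter_upwards [Metric.tendsto_nhds.1 (hθ k) (ε / 2) (half_pos hε)] with n hn
    rw [Real.dist_eq, sub_zero] at hn ⊢
    have h1 : |(ψ n - θ n) (f - G k)| ≤ 2 * ‖T‖ * (ε / (2 * (2 * ‖T‖ + 1))) :=
      functional_le_of_bound_on (hnorm n) (fun f hf => by
        have := hθZ n f (Or.inr hf)
        simp [hψS n f hf, this]) (by positivity) hk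
    have h2 : 2 * ‖T‖ * (ε / (2 * (2 * ‖T‖ + 1))) ≤ ε / 2 := by
      rw [← mul_div_assoc, div_le_div_iff₀ (by positivity) (by positivity)]
      nlinarith [norm_nonneg T]
    have h3 : (ψ n - θ n) f = (ψ n - θ n) (f - G k) + (ψ n - θ n) (G k) := by
      rw [← map_add, sub_add_cancel]
    rw [h3]
    exact (abs_add_le _ _).trans_lt (by linarith)
  obtain ⟨T', hT', hTn⟩ := exists_operator_c0 (by positivity) _ hnorm hlim
  refine ⟨T', fun y => ?_, hTn⟩
  ext n
  rw [hT', sub_apply, hψY n y, hθZ n y (Or.inl y.2), sub_zero]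

/-! ### Domination of functionals by regular measures -/

section Variation

open scoped NNReal CompactlySupported

variable {K : Type*} [TopologicalSpace K]

/-- The values of a functional on the order interval `[-f, f]`. -/
def orderIntervalValues (φ : StrongDual ℝ C(K, ℝ)) (f : C_c(K, ℝ≥0)) : Set ℝ :=
  {r | ∃ g : C(K, ℝ), (∀ x, |g x| ≤ f x) ∧ φ g = r}

theorem zero_mem_orderIntervalValues (φ : StrongDual ℝ C(K, ℝ)) (f : C_c(K, ℝ≥0)) :
    0 ∈ orderIntervalValues φ f :=
  ⟨0, fun x => by simp, map_zero φ⟩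

theorem bddAbove_orderIntervalValues [CompactSpace K] (φ : StrongDual ℝ C(K, ℝ)) (f : C_c(K, ℝ≥0)) :
    BddAbove (orderIntervalValues φ f) := by
  obtain ⟨M, hM⟩ := (isCompact_range f.continuous).bddAbove
  refine ⟨‖φ‖ * M, ?_⟩
  rintro _ ⟨g, hg, rfl⟩
  refine (le_abs_self _).trans (φ.le_of_opNorm_le_of_le le_rfl ?_)
  refine (ContinuousMap.norm_le _ M.2).2 ?_
  exact fun x => (hg x).trans (by exact_mod_cast hM ⟨x, rfl⟩)

/-- The variation of a functional on `C(K)`. -/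
noncomputable def functionalVariation (φ : StrongDual ℝ C(K, ℝ)) (f : C_c(K, ℝ≥0)) : ℝ :=
  sSup (orderIntervalValues φ f)

theorem functionalVariation_le (φ : StrongDual ℝ C(K, ℝ)) {f : C_c(K, ℝ≥0)} {c : ℝ}
    (h : ∀ g : C(K, ℝ), (∀ x, |g x| ≤ f x) → φ g ≤ c) : functionalVariation φ f ≤ c :=
  csSup_le ⟨_, zero_mem_orderIntervalValues φ f⟩ (by rintro _ ⟨g, hg, rfl⟩; exact h g hg)

variable [CompactSpace K]

theorem le_functionalVariation (φ : StrongDual ℝ C(K, ℝ)) {f : C_c(K, ℝ≥0)} {g : C(K, ℝ)}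
    (hg : ∀ x, |g x| ≤ f x) : φ g ≤ functionalVariation φ f :=
  le_csSup (bddAbove_orderIntervalValues φ f) ⟨g, hg, rfl⟩

theorem functionalVariation_nonneg (φ : StrongDual ℝ C(K, ℝ)) (f : C_c(K, ℝ≥0)) :
    0 ≤ functionalVariation φ f :=
  le_csSup (bddAbove_orderIntervalValues φ f) (zero_mem_orderIntervalValues φ f)

theorem functionalVariation_add (φ : StrongDual ℝ C(K, ℝ)) (f₁ f₂ : C_c(K, ℝ≥0)) :
    functionalVariation φ (f₁ + f₂) = functionalVariation φ f₁ + functionalVariation φ f₂ := by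
  apply le_antisymm
  · refine functionalVariation_le φ fun g hg => ?_
    -- Riesz decomposition: cutting `g` off at `± f₁` leaves a remainder bounded by `f₂`.
    let g₁ : C(K, ℝ) := ⟨fun x => max (-(f₁ x : ℝ)) (min (f₁ x) (g x)), by fun_prop⟩
    have h₁ : ∀ x, |g₁ x| ≤ f₁ x := fun x => by
      rw [abs_le]
      have := (f₁ x).2
      exact ⟨le_max_left _ _, max_le (by linarith) (min_le_left _ _)⟩
    have h₂ : ∀ x, |(g - g₁) x| ≤ f₂ x := fun x => by
      have h := hg x
      have e₁ := (f₁ x).2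
      have e₂ := (f₂ x).2
      simp only [CompactlySupportedContinuousMap.add_apply, NNReal.coe_add] at h
      rw [abs_le] at h ⊢
      simp only [ContinuousMap.sub_apply, g₁, ContinuousMap.coe_mk]
      rcases le_total (f₁ x : ℝ) (g x) with h' | h'
      · rw [min_eq_left h', max_eq_right (by linarith)]
        exact ⟨by linarith, by linarith⟩
      · rw [min_eq_right h']
        rcases le_total (-(f₁ x) : ℝ) (g x) with h'' | h''
        · rw [max_eq_right h'']
          exact ⟨by linarith, by linarith⟩
        · rw [max_eq_left h'']
          exact ⟨by linarith, by linarith⟩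
    have : φ g = φ g₁ + φ (g - g₁) := by rw [← map_add, add_sub_cancel]
    rw [this]
    exact add_le_add (le_functionalVariation φ h₁) (le_functionalVariation φ h₂)
  · rw [← le_sub_iff_add_le]
    refine functionalVariation_le φ fun g₁ h₁ => ?_
    rw [le_sub_comm]
    refine functionalVariation_le φ fun g₂ h₂ => ?_
    rw [le_sub_iff_add_le, add_comm, ← map_add]
    refine le_functionalVariation φ fun x => ?_
    have := abs_add_le (g₁ x) (g₂ x)
    have e₁ := h₁ x
    have e₂ := h₂ x
    simp only [CompactlySupportedContinuousMap.add_apply, NNReal.coe_add, ContinuousMap.add_apply]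
    linarith

theorem mul_functionalVariation_le (φ : StrongDual ℝ C(K, ℝ)) (r : ℝ≥0) (f : C_c(K, ℝ≥0)) :
    r * functionalVariation φ f ≤ functionalVariation φ (r • f) := by
  rcases eq_or_ne r 0 with rfl | hr
  · simpa using functionalVariation_nonneg φ _
  have hr' : (0 : ℝ) < r := by exact_mod_cast pos_iff_ne_zero.2 hr
  rw [← le_div_iff₀' hr']
  refine functionalVariation_le φ fun g hg => ?_
  rw [le_div_iff₀' hr']
  have : (r : ℝ) * φ g = φ ((r : ℝ) • g) := by rw [map_smul, smul_eq_mul]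
  rw [this]
  refine le_functionalVariation φ fun x => ?_
  simp only [ContinuousMap.smul_apply, CompactlySupportedContinuousMap.smul_apply, smul_eq_mul,
    NNReal.coe_mul, abs_mul, abs_of_pos hr']
  exact mul_le_mul_of_nonneg_left (hg x) hr'.le

theorem functionalVariation_smul (φ : StrongDual ℝ C(K, ℝ)) (r : ℝ≥0) (f : C_c(K, ℝ≥0)) :
    functionalVariation φ (r • f) = r * functionalVariation φ f := by
  refine le_antisymm ?_ (mul_functionalVariation_le φ r f)
  rcases eq_or_ne r 0 with rfl | hr
  · rw [zero_smul]
    refine functionalVariation_le φ fun g hg => ?_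
    have : g = 0 := by ext x; simpa using hg x
    simp [this]
  have hr' : (0 : ℝ) < r := by exact_mod_cast pos_iff_ne_zero.2 hr
  -- The reverse inequality is the same one for `r⁻¹`.
  have h := mul_functionalVariation_le φ r⁻¹ (r • f)
  rwa [smul_smul, inv_mul_cancel₀ hr, one_smul, NNReal.coe_inv, inv_mul_le_iff₀ hr'] at h

/-- The variation as a linear functional. -/
noncomputable def functionalVariationLinear (φ : StrongDual ℝ C(K, ℝ)) :
    C_c(K, ℝ≥0) →ₗ[ℝ≥0] ℝ≥0 where
  toFun f := ⟨functionalVariation φ f, functionalVariation_nonneg φ f⟩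
  map_add' f g := NNReal.eq (functionalVariation_add φ f g)
  map_smul' r f := NNReal.eq (functionalVariation_smul φ r f)

/-- Every functional on `C(K)` is dominated by a finite regular measure. -/
theorem exists_regular_measure_dominating [T2Space K] [MeasurableSpace K] [BorelSpace K]
    (φ : StrongDual ℝ C(K, ℝ)) :
    ∃ μ : Measure K, IsFiniteMeasure μ ∧ μ.Regular ∧ ∀ f : C(K, ℝ), |φ f| ≤ ∫ x, |f x| ∂μ := by
  refine ⟨NNRealRMK.rieszMeasure (functionalVariationLinear φ), inferInstance, inferInstance,
    fun f => ?_⟩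
  let F : C_c(K, ℝ≥0) := ⟨⟨fun x => ‖f x‖₊, by fun_prop⟩, .of_compactSpace _⟩
  have h := NNRealRMK.integral_rieszMeasure (functionalVariationLinear φ) F
  have hF : ∀ x, (F x : ℝ) = |f x| := fun x => rfl
  simp only [hF] at h
  rw [h, abs_le']
  constructor
  · exact le_functionalVariation φ fun x => (hF x).ge
  · rw [← map_neg]
    exact le_functionalVariation φ fun x => by rw [hF, ContinuousMap.neg_apply, abs_neg]

end Variation

/-! ### Carriers of regular measures: Property (M), scattered spaces, compact lines -/

/-- Every finite regular measure is carried by the closure of a countable set. -/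
def RegularMeasuresSeparablyCarried (K : Type*) [TopologicalSpace K] [MeasurableSpace K] : Prop :=
  ∀ μ : Measure K, IsFiniteMeasure μ → μ.Regular → ∃ D : Set K, D.Countable ∧ μ (closure D)ᶜ = 0

theorem IsMonolithic.hasC0ExtensionProperty {K : Type u} [TopologicalSpace K]
    [CompactSpace K] [T2Space K] [MeasurableSpace K] [BorelSpace K] (hK : IsMonolithic K)
    (hc : RegularMeasuresSeparablyCarried K) : HasC0ExtensionProperty 2 C(K, ℝ) := by
  refine hK.hasC0ExtensionProperty_of_functionals fun φ => ?_
  obtain ⟨μ, hfin, hreg, hμ⟩ := exists_regular_measure_dominating φ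
  obtain ⟨D, hD, hD0⟩ := hc μ hfin hreg
  refine ⟨D, hD, fun f hf => ?_⟩
  have h : ∫ x, |f x| ∂μ = 0 := by
    refine integral_eq_zero_of_ae ?_
    filter_upwards [compl_mem_ae_iff.2 hD0] with x hx
    simp [hf x (not_not.1 hx)]
  exact abs_eq_zero.1 (le_antisymm ((hμ f).trans h.le) (abs_nonneg _))

theorem totalVariation_toSignedMeasure {K : Type*} [MeasurableSpace K] (μ : Measure K)
    [IsFiniteMeasure μ] : μ.toSignedMeasure.totalVariation = μ := by
  let j : JordanDecomposition K := ⟨μ, 0, .zero_right⟩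
  have hj : μ.toSignedMeasure.toJordanDecomposition = j :=
    SignedMeasure.toJordanDecomposition_eq (by
      simp [j, JordanDecomposition.toSignedMeasure])
  simp [SignedMeasure.totalVariation, hj, j]

theorem HasPropertyM.regularMeasuresSeparablyCarried {K : Type u} [TopologicalSpace K]
    [MeasurableSpace K] [BorelSpace K] (hK : HasPropertyM K) :
    RegularMeasuresSeparablyCarried K := by
  intro μ hfin hreg
  have h := hK μ.toSignedMeasure
  rw [totalVariation_toSignedMeasure] at h
  obtain ⟨D, hD, hDd⟩ := (h hreg).exists_countable_dense
  refine ⟨Subtype.val '' D, hD.image _, measure_mono_null ?_ μ.measure_compl_support_of_regular⟩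
  exact Set.compl_subset_compl.2 (Subtype.dense_iff.1 hDd)

/-- Regular measures on a scattered space are carried by their atoms. -/
theorem IsScatteredSpace.regularMeasuresSeparablyCarried {K : Type u} [TopologicalSpace K]
    [T2Space K] [MeasurableSpace K] [BorelSpace K] (hK : IsScatteredSpace K) :
    RegularMeasuresSeparablyCarried K := by
  intro μ hfin hreg
  let A : Set K := {x | 0 < μ {x}}
  have hA : A.Countable :=
    Measure.countable_meas_pos_of_disjoint_iUnion (μ := μ) (As := fun x : K => {x})
      (fun x => measurableSet_singleton x) (fun x y hxy => by simpa using hxy)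
  refine ⟨A, hA, ?_⟩
  -- If `ν` were nonzero, an isolated point of its support would be an atom of `μ` outside `closure
  -- A`.
  let ν := μ.restrict (closure A)ᶜ
  have hνreg : ν.Regular := by infer_instance
  by_contra h0
  have hne : ν.support.Nonempty := by
    rw [Set.nonempty_iff_ne_empty]
    intro he
    have h1 := ν.measure_compl_support_of_regular
    rw [he, Set.compl_empty, Measure.restrict_apply_univ] at h1
    exact h0 h1
  have hd := hK ν.support Measure.isClosed_support
  obtain ⟨y, hy⟩ := @Dense.nonempty _ _ _ hne.to_subtype hd
  obtain ⟨V, hV, hVy⟩ := isOpen_induced_iff.1 (show IsOpen ({y} : Set ν.support) from hy)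
  have hyV : (y : K) ∈ V := by
    have : y ∈ Subtype.val ⁻¹' V := hVy ▸ rfl
    exact this
  have h1 : 0 < ν V := (Measure.mem_support_iff_forall _).1 y.2 V (hV.mem_nhds hyV)
  have h2 : ν V ≤ ν {(y : K)} + ν ν.supportᶜ := by
    refine (measure_mono fun x hx => ?_).trans (measure_union_le _ _)
    by_cases hxs : x ∈ ν.support
    · left
      have : (⟨x, hxs⟩ : ν.support) ∈ ({y} : Set ν.support) := hVy ▸ hx
      exact congrArg Subtype.val this
    · exact Or.inr hxs
  rw [ν.measure_compl_support_of_regular, add_zero] at h2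
  have h3 : 0 < ν {(y : K)} := h1.trans_le h2
  have h4 : (y : K) ∈ A := h3.trans_le (Measure.restrict_apply_le _ _)
  refine h3.ne' ?_
  rw [Measure.restrict_apply (measurableSet_singleton _),
    Set.singleton_inter_eq_empty.2 (not_not.2 (subset_closure h4)), measure_empty]

/-- Regular measures on compact lines are carried by separable closed sets. -/
theorem regularMeasuresSeparablyCarried_of_linearOrder {K : Type u} [LinearOrder K]
    [TopologicalSpace K] [OrderTopology K] [CompactSpace K] [MeasurableSpace K] [BorelSpace K] :
    RegularMeasuresSeparablyCarried K := by
  intro μ hfin hreg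
  rcases isEmpty_or_nonempty K with hK | hK
  · exact ⟨∅, Set.countable_empty, by simp [Set.eq_empty_of_isEmpty]⟩
  obtain ⟨b, hb⟩ := isCompact_univ.exists_isLeast (Set.univ_nonempty (α := K))
  obtain ⟨t, ht⟩ := isCompact_univ.exists_isGreatest (Set.univ_nonempty (α := K))
  -- `x` is the `q`-quantile, the least point with `q ≤ μ (Iic x)`. It exists by compactness and
  -- right continuity of the distribution function, which comes from outer regularity; `x < c` comes
  -- from inner regularity.
  have key : ∀ q : ℚ, ∃ x : K, ∀ a c : K, μ.real (Set.Iic a) < q → q < μ.real (Set.Iio c) →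
      a < x ∧ x < c := by
    intro q
    by_cases hne : {x : K | (q : ℝ) ≤ μ.real (Set.Iic x)}.Nonempty
    swap
    -- No quantile exists and the condition is vacuous, so `b` is a dummy value.
    · refine ⟨b, fun a c _ hc => (hne ⟨c, ?_⟩).elim⟩
      exact hc.le.trans (measureReal_mono Set.Iio_subset_Iic_self)
    have hclosed : IsClosed {x : K | (q : ℝ) ≤ μ.real (Set.Iic x)} := by
      rw [← isOpen_compl_iff, isOpen_iff_mem_nhds]
      intro x hx
      have hx' : μ.real (Set.Iic x) < q := not_le.1 hx
      obtain ⟨U, hxU, hU, hUq⟩ := (Set.Iic x).exists_isOpen_lt_of_lt (μ := μ)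
        (ENNReal.ofReal q) (by
          rw [measureReal_def] at hx'
          exact (ENNReal.lt_ofReal_iff_toReal_lt (measure_ne_top _ _)).2 hx')
      have hUr : μ.real U < q := by
        rw [measureReal_def]
        exact (ENNReal.lt_ofReal_iff_toReal_lt (measure_ne_top _ _)).1 hUq
      by_cases hxt : ∃ l, x < l
      · obtain ⟨l, hl, hlU⟩ := exists_Ico_subset_of_mem_nhds (hU.mem_nhds (hxU le_rfl)) hxt
        filter_upwards [Iio_mem_nhds hl] with y hy
        refine not_le.2 (lt_of_le_of_lt (measureReal_mono fun z hz => ?_) hUr)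
        rcases le_total z x with h | h
        · exact hxU h
        · exact hlU ⟨h, lt_of_le_of_lt hz hy⟩
      · push Not at hxt
        filter_upwards with y
        exact not_le.2 (lt_of_le_of_lt (measureReal_mono fun z _ => hxt z) hx')
    obtain ⟨x, hx⟩ := hclosed.isCompact.exists_isLeast hne
    refine ⟨x, fun a c ha hc => ⟨?_, ?_⟩⟩
    · by_contra hxa
      exact absurd (hx.1.trans (measureReal_mono (Set.Iic_subset_Iic.2 (not_lt.1 hxa))))
        (not_le.2 ha)
    · have hq0 : (0 : ℝ) ≤ q := measureReal_nonneg.trans ha.le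
      obtain ⟨C, hCc, hC, hCq⟩ := (isOpen_Iio (a := c)).exists_lt_isCompact (μ := μ)
        ((ENNReal.ofReal_lt_iff_lt_toReal hq0 (measure_ne_top _ _)).2 hc)
      obtain ⟨m, hm⟩ := hC.exists_isGreatest
        (nonempty_of_measure_ne_zero hCq.ne_bot)
      refine lt_of_le_of_lt (hx.2 ?_) (hCc hm.1)
      exact ((ENNReal.ofReal_lt_iff_lt_toReal hq0 (measure_ne_top _ _)).1 hCq).le.trans
        (measureReal_mono hm.2)
  choose x hx using key
  -- The endpoints are added because open intervals form a neighborhood base only at the other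
  -- points.
  refine ⟨insert b (insert t (Set.range x)),
    ((Set.countable_range x).insert _).insert _, measure_mono_null ?_
      μ.measure_compl_support_of_regular⟩
  rw [Set.compl_subset_compl]
  intro s hs
  rw [mem_closure_iff_nhds]
  intro U hU
  rcases (hb.2 (Set.mem_univ s)).eq_or_lt with rfl | hbs
  · exact ⟨b, mem_of_mem_nhds hU, by simp⟩
  rcases (ht.2 (Set.mem_univ s)).eq_or_lt with rfl | hst
  · exact ⟨s, mem_of_mem_nhds hU, by simp⟩
  obtain ⟨a, c, hsac, hacU⟩ := (mem_nhds_iff_exists_Ioo_subset' ⟨b, hbs⟩ ⟨t, hst⟩).1 hU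
  have hpos : 0 < μ.real (Set.Ioo a c) :=
    ENNReal.toReal_pos ((Measure.mem_support_iff_forall _).1 hs _
      (isOpen_Ioo.mem_nhds hsac)).ne' (measure_ne_top _ _)
  have hlt : μ.real (Set.Iic a) < μ.real (Set.Iio c) := by
    have hdisj : Disjoint (Set.Iic a) (Set.Ioo a c) :=
      Set.disjoint_left.2 fun z hz hz' => not_lt.2 hz hz'.1
    rw [← Set.Iic_union_Ioo_eq_Iio (hsac.1.trans hsac.2),
      measureReal_union hdisj measurableSet_Ioo]
    linarith
  obtain ⟨q, hq1, hq2⟩ := exists_rat_btwn hlt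
  exact ⟨x q, hacU (hx q a c hq1 hq2), by simp⟩

/-! ### A Cantor–Bendixson argument for random closed sets -/

section RandomClosedSets

open scoped ENNReal

variable {Q Ω : Type*} [TopologicalSpace Q] [FirstCountableTopology Q] [Countable Q]
  [MeasurableSpace Ω]

/-- A random closed subset of `Q`, presented by the events that it contains a given point. -/
structure IsClosedFamily (Λ : Q → Set Ω) : Prop where
  measurableSet : ∀ x, MeasurableSet (Λ x)
  isClosed : ∀ ω, IsClosed {x | ω ∈ Λ x}

/-- Up to small measure, the part of the event `B x y` outside `Λ x` can be avoided locally, near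
a dense set of points. -/
def IsLocallyAvoidableOff (μ : Measure Ω) (B : Q → Q → Set Ω) (Λ : Q → Set Ω) : Prop :=
  ∀ V : Set Q, IsOpen V → V.Nonempty → ∀ η : ℝ≥0∞, η ≠ 0 →
    ∃ W ⊆ V, IsOpen W ∧ W.Nonempty ∧ ∀ x ∈ W, ∀ y ∈ W, μ (B x y \ Λ x) ≤ η

omit [MeasurableSpace Ω] in
theorem iInter_sdiff_const (s : ℕ → Set Ω) (t : Set Ω) : ⋂ k, (s k \ t) = (⋂ k, s k) \ t := by
  simp only [sdiff_eq, Set.inf_eq_inter, Set.iInter_inter]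

omit [Countable Q] [MeasurableSpace Ω] in
theorem exists_iInter_nhds_eq_iInter_nat (x : Q) : ∃ b : ℕ → Set Q, (∀ k, b k ∈ 𝓝 x) ∧
    Antitone b ∧ ∀ G : Set Q → Set Ω, Monotone G → ⋂ W ∈ 𝓝 x, G W = ⋂ k, G (b k) := by
  obtain ⟨b, hb⟩ := (𝓝 x).exists_antitone_basis
  refine ⟨b, fun k => hb.mem k, hb.antitone, fun G hG => subset_antisymm ?_ ?_⟩
  · exact Set.subset_iInter fun k => Set.biInter_subset_of_mem (hb.mem k)
  · refine Set.subset_iInter₂ fun W hW => ?_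
    obtain ⟨k, hk⟩ := hb.mem_iff.1 hW
    exact (Set.iInter_subset _ k).trans (hG hk)

omit [Countable Q] in
theorem measurableSet_iInter_nhds {G : Set Q → Set Ω} (hG : Monotone G)
    (hm : ∀ V, MeasurableSet (G V)) (x : Q) : MeasurableSet (⋂ W ∈ 𝓝 x, G W) := by
  obtain ⟨b, _, _, hb⟩ := exists_iInter_nhds_eq_iInter_nat (Ω := Ω) x
  rw [hb G hG]
  exact .iInter fun k => hm _

-- Continuity of the measure from above, along a countable neighborhood base.
omit [Countable Q] in
theorem exists_isOpen_measure_sdiff_iInter_nhds_le (μ : Measure Ω) [IsFiniteMeasure μ]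
    {G : Set Q → Set Ω} (hG : Monotone G) (hm : ∀ V, MeasurableSet (G V)) (x : Q) {η : ℝ≥0∞}
    (hη : η ≠ 0) : ∃ V, IsOpen V ∧ x ∈ V ∧ μ (G V \ ⋂ W ∈ 𝓝 x, G W) ≤ η := by
  have hL := measurableSet_iInter_nhds hG hm x
  obtain ⟨b, hbx, hba, hb⟩ := exists_iInter_nhds_eq_iInter_nat (Ω := Ω) x
  have h := tendsto_measure_iInter_atTop (μ := μ) (s := fun k => G (b k) \ ⋂ W ∈ 𝓝 x, G W)
    (fun k => ((hm _).diff hL).nullMeasurableSet)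
    (fun i j hij => Set.sdiff_subset_sdiff_left (hG (hba hij))) ⟨0, measure_ne_top _ _⟩
  have h0 : ⋂ k, (G (b k) \ ⋂ W ∈ 𝓝 x, G W) = ∅ := by
    rw [iInter_sdiff_const, hb G hG, Set.sdiff_self]
  rw [h0, measure_empty] at h
  obtain ⟨k, hk⟩ := (h.eventually (gt_mem_nhds (pos_iff_ne_zero.2 hη))).exists
  exact ⟨interior (b k), isOpen_interior, mem_interior_iff_mem_nhds.2 (hbx k),
    (measure_mono (Set.sdiff_subset_sdiff_left (hG interior_subset))).trans hk.le⟩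

namespace IsClosedFamily

variable {Λ : Q → Set Ω}

omit [TopologicalSpace Q] [FirstCountableTopology Q] [Countable Q] [MeasurableSpace Ω] in
theorem monotone_biUnion (Λ : Q → Set Ω) : Monotone fun V : Set Q => ⋃ x ∈ V, Λ x :=
  fun _ _ h => Set.biUnion_subset_biUnion_left h

omit [FirstCountableTopology Q] [Countable Q] in
theorem iInter_nhds (h : IsClosedFamily Λ) (x : Q) : ⋂ W ∈ 𝓝 x, ⋃ y ∈ W, Λ y = Λ x := by
  refine subset_antisymm (fun ω hω => ?_) ?_
  · refine (h.isClosed ω).closure_subset (mem_closure_iff_nhds.2 fun W hW => ?_)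
    obtain ⟨y, hy, hωy⟩ := Set.mem_iUnion₂.1 (Set.mem_iInter₂.1 hω W hW)
    exact ⟨y, hy, hωy⟩
  · exact Set.subset_iInter₂ fun W hW => Set.subset_biUnion_of_mem (mem_of_mem_nhds hW)

omit [FirstCountableTopology Q] in
theorem measurableSet_biUnion (h : IsClosedFamily Λ) (V : Set Q) :
    MeasurableSet (⋃ x ∈ V, Λ x) :=
  .biUnion V.to_countable fun x _ => h.measurableSet x

theorem exists_isOpen_measure_sdiff_le (h : IsClosedFamily Λ) (μ : Measure Ω) [IsFiniteMeasure μ]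
    (x : Q) {η : ℝ≥0∞} (hη : η ≠ 0) :
    ∃ V, IsOpen V ∧ x ∈ V ∧ μ ((⋃ y ∈ V, Λ y) \ Λ x) ≤ η := by
  have := exists_isOpen_measure_sdiff_iInter_nhds_le μ (monotone_biUnion Λ)
    h.measurableSet_biUnion x hη
  rwa [h.iInter_nhds x] at this

/-- Near a dense set of points, a random closed set is almost locally constant. -/
theorem exists_isOpen_forall_measure_sdiff_le (h : IsClosedFamily Λ) (μ : Measure Ω)
    [IsFiniteMeasure μ] {V : Set Q} (hV : IsOpen V) (hne : V.Nonempty) {η : ℝ≥0∞} (hη : η ≠ 0) :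
    ∃ W ⊆ V, IsOpen W ∧ W.Nonempty ∧ ∀ y ∈ W, μ ((⋃ x ∈ W, Λ x) \ Λ y) ≤ η := by
  -- Take `W` nearly minimizing the measure of the union. Each `Λ y` is a limit of unions over small
  -- neighborhoods, so it has at least the infimal measure and nearly fills the union over `W`.
  let S : Set ℝ≥0∞ := {r | ∃ W ⊆ V, IsOpen W ∧ W.Nonempty ∧ μ (⋃ x ∈ W, Λ x) = r}
  have hS : sInf S ≠ ∞ :=
    ne_top_of_le_ne_top (measure_ne_top μ _) (sInf_le ⟨V, subset_rfl, hV, hne, rfl⟩)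
  obtain ⟨_, ⟨W, hWV, hW, hWne, rfl⟩, hlt⟩ := sInf_lt_iff.1 (ENNReal.lt_add_right hS hη)
  refine ⟨W, hWV, hW, hWne, fun y hy => ?_⟩
  have hle : sInf S ≤ μ (Λ y) := by
    refine ENNReal.le_of_forall_pos_le_add fun δ hδ _ => ?_
    obtain ⟨U, hU, hyU, hδU⟩ := h.exists_isOpen_measure_sdiff_le μ y
      (ENNReal.coe_ne_zero.2 hδ.ne')
    have h1 : sInf S ≤ μ (⋃ x ∈ U ∩ W, Λ x) :=
      sInf_le ⟨U ∩ W, Set.inter_subset_right.trans hWV, hU.inter hW, ⟨y, hyU, hy⟩, rfl⟩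
    refine h1.trans ((measure_mono (monotone_biUnion Λ Set.inter_subset_left)).trans ?_)
    refine (measure_mono (Set.subset_union_left (t := Λ y))).trans ?_
    rw [← Set.sdiff_union_self]
    exact (measure_union_le _ _).trans (by rw [add_comm]; gcongr)
  rw [measure_sdiff (Set.subset_biUnion_of_mem (u := Λ) hy) (h.measurableSet y).nullMeasurableSet
    (measure_ne_top _ _), tsub_le_iff_left]
  exact hlt.le.trans (by gcongr)

omit [FirstCountableTopology Q] [Countable Q] in
theorem inter {Λ' : Q → Set Ω} (h : IsClosedFamily Λ) (h' : IsClosedFamily Λ') :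
    IsClosedFamily fun x => Λ x ∩ Λ' x :=
  ⟨fun x => (h.measurableSet x).inter (h'.measurableSet x),
    fun ω => (h.isClosed ω).inter (h'.isClosed ω)⟩

omit [FirstCountableTopology Q] [Countable Q] in
theorem iInter {Λ : ℕ → Q → Set Ω} (h : ∀ n, IsClosedFamily (Λ n)) :
    IsClosedFamily fun x => ⋂ n, Λ n x :=
  ⟨fun x => .iInter fun n => (h n).measurableSet x, fun ω => by
    simp only [Set.mem_iInter, Set.ofPred_forall]
    exact isClosed_iInter fun n => (h n).isClosed ω⟩

end IsClosedFamily

variable {μ : Measure Ω} {B : Q → Q → Set Ω}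

namespace IsLocallyAvoidableOff

omit [FirstCountableTopology Q] [Countable Q] in
theorem inter {Λ Λ' : Q → Set Ω} (h : IsLocallyAvoidableOff μ B Λ)
    (h' : IsLocallyAvoidableOff μ B Λ') : IsLocallyAvoidableOff μ B fun x => Λ x ∩ Λ' x := by
  intro V hV hne η hη
  have hη2 : η / 2 ≠ 0 := (ENNReal.half_pos hη).ne'
  obtain ⟨W, hWV, hW, hWne, hWη⟩ := h V hV hne (η / 2) hη2
  obtain ⟨U, hUW, hU, hUne, hUη⟩ := h' W hW hWne (η / 2) hη2
  refine ⟨U, hUW.trans hWV, hU, hUne, fun x hx y hy => ?_⟩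
  rw [Set.sdiff_inter, ← ENNReal.add_halves η]
  exact (measure_union_le _ _).trans
    (add_le_add (hWη x (hUW hx) y (hUW hy)) (hUη x hx y hy))

/-- The intersection is almost constant on some open set, and at one point `x` there it is close to
a single `Λ n x`; avoidability off `Λ n` near `x` then transfers at the cost of four errors `η / 4`.
-/
theorem iInter [IsFiniteMeasure μ] {Λ : ℕ → Q → Set Ω} (hc : ∀ n, IsClosedFamily (Λ n))
    (ha : ∀ n x, Λ (n + 1) x ⊆ Λ n x) (h : ∀ n, IsLocallyAvoidableOff μ B (Λ n)) :
    IsLocallyAvoidableOff μ B fun x => ⋂ n, Λ n x := by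
  intro V hV hne η hη
  have hη4 : η / 4 ≠ 0 := (ENNReal.div_pos hη (by simp)).ne'
  have hcI := IsClosedFamily.iInter hc
  obtain ⟨V₁, hV₁V, hV₁, ⟨x, hx⟩, hV₁η⟩ :=
    hcI.exists_isOpen_forall_measure_sdiff_le μ hV hne hη4
  obtain ⟨n, hn⟩ : ∃ n, μ (Λ n x \ ⋂ n, Λ n x) ≤ η / 4 := by
    have hanti : Antitone fun n => Λ n x := antitone_nat_of_succ_le fun n => ha n x
    have hlim := tendsto_measure_iInter_atTop (μ := μ) (s := fun n => Λ n x \ ⋂ n, Λ n x)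
      (fun n => (((hc n).measurableSet x).diff (hcI.measurableSet x)).nullMeasurableSet)
      (fun i j hij => Set.sdiff_subset_sdiff_left (hanti hij)) ⟨0, measure_ne_top _ _⟩
    rw [iInter_sdiff_const, Set.sdiff_self, measure_empty] at hlim
    exact (hlim.eventually (gt_mem_nhds (pos_iff_ne_zero.2 hη4))).exists.imp fun _ h => h.le
  obtain ⟨V₂, hV₂, hxV₂, hV₂η⟩ := (hc n).exists_isOpen_measure_sdiff_le μ x hη4
  obtain ⟨W, hWV, hW, hWne, hWη⟩ := h n (V₁ ∩ V₂) (hV₁.inter hV₂) ⟨x, hx, hxV₂⟩ (η / 4) hη4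
  refine ⟨W, hWV.trans (Set.inter_subset_left.trans hV₁V), hW, hWne, fun y hy z hz => ?_⟩
  have hsub : B y z \ ⋂ n, Λ n y ⊆ (B y z \ Λ n y) ∪ ((⋃ y ∈ V₂, Λ n y) \ Λ n x) ∪
      (Λ n x \ ⋂ n, Λ n x) ∪ ((⋃ y ∈ V₁, ⋂ n, Λ n y) \ ⋂ n, Λ n y) := by
    rintro ω ⟨hωB, hω⟩
    by_cases h1 : ω ∈ Λ n y
    swap
    · exact Or.inl (Or.inl (Or.inl ⟨hωB, h1⟩))
    by_cases h2 : ω ∈ Λ n x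
    swap
    · exact Or.inl (Or.inl (Or.inr ⟨Set.mem_biUnion (hWV hy).2 h1, h2⟩))
    by_cases h3 : ω ∈ ⋂ n, Λ n x
    · exact Or.inr ⟨Set.mem_biUnion hx h3, hω⟩
    · exact Or.inl (Or.inr ⟨h2, h3⟩)
  calc μ (B y z \ ⋂ n, Λ n y) ≤ η / 4 + η / 4 + η / 4 + η / 4 := by
        refine (measure_mono hsub).trans ((measure_union_le _ _).trans ?_)
        refine add_le_add ((measure_union_le _ _).trans ?_) (hV₁η y (hWV hy).1)
        refine add_le_add ((measure_union_le _ _).trans ?_) hn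
        exact add_le_add (hWη y hy z hz) hV₂η
    _ = η := by
        have : η / 4 + η / 4 + η / 4 + η / 4 = 4 * (η / 4) := by ring
        rw [this, ENNReal.mul_div_cancel (by norm_num) (by norm_num)]

end IsLocallyAvoidableOff

/-- The pairs of points of `V` in the random set at which `B` occurs. -/
def badPairs (B : Q → Q → Set Ω) (Λ : Q → Set Ω) (V : Set Q) : Set Ω :=
  ⋃ x ∈ V, ⋃ y ∈ V, Λ x ∩ Λ y ∩ B x y

/-- The derived random set: the points near which `B` occurs within the random set. -/
def derivedFamily (B : Q → Q → Set Ω) (Λ : Q → Set Ω) (x : Q) : Set Ω :=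
  ⋂ V ∈ 𝓝 x, badPairs B Λ V

omit [TopologicalSpace Q] [FirstCountableTopology Q] [Countable Q] [MeasurableSpace Ω] in
theorem mem_badPairs {Λ : Q → Set Ω} {V : Set Q} {ω : Ω} :
    ω ∈ badPairs B Λ V ↔ ∃ x ∈ V, ∃ y ∈ V, ω ∈ Λ x ∧ ω ∈ Λ y ∧ ω ∈ B x y := by
  simp only [badPairs, Set.mem_iUnion, Set.mem_inter_iff, exists_prop, and_assoc]

omit [TopologicalSpace Q] [FirstCountableTopology Q] [Countable Q] [MeasurableSpace Ω] in
theorem monotone_badPairs (B : Q → Q → Set Ω) (Λ : Q → Set Ω) : Monotone (badPairs B Λ) := by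
  intro V W h ω hω
  obtain ⟨x, hx, y, hy, h'⟩ := mem_badPairs.1 hω
  exact mem_badPairs.2 ⟨x, h hx, y, h hy, h'⟩

omit [FirstCountableTopology Q] in
theorem measurableSet_badPairs (hB : ∀ x y, MeasurableSet (B x y)) {Λ : Q → Set Ω}
    (h : IsClosedFamily Λ) (V : Set Q) : MeasurableSet (badPairs B Λ V) :=
  .biUnion V.to_countable fun x _ => .biUnion V.to_countable fun y _ =>
    ((h.measurableSet x).inter (h.measurableSet y)).inter (hB x y)

omit [FirstCountableTopology Q] [Countable Q] in
theorem derivedFamily_subset {Λ : Q → Set Ω} (h : IsClosedFamily Λ) (x : Q) :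
    derivedFamily B Λ x ⊆ Λ x := by
  rw [← h.iInter_nhds x]
  refine Set.iInter₂_mono fun W _ ω hω => ?_
  obtain ⟨y, hy, _, _, h', _⟩ := mem_badPairs.1 hω
  exact Set.mem_biUnion hy h'

theorem IsClosedFamily.derivedFamily (hB : ∀ x y, MeasurableSet (B x y)) {Λ : Q → Set Ω}
    (h : IsClosedFamily Λ) : IsClosedFamily (derivedFamily B Λ) := by
  refine ⟨fun x => measurableSet_iInter_nhds (monotone_badPairs B Λ)
    (measurableSet_badPairs hB h) x, fun ω => ?_⟩
  rw [← isOpen_compl_iff, isOpen_iff_mem_nhds]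
  intro x hx
  simp only [Set.mem_compl_iff, Set.mem_ofPred_eq, _root_.derivedFamily, Set.mem_iInter,
    not_forall] at hx
  obtain ⟨V, hV, hω⟩ := hx
  filter_upwards [eventually_mem_nhds_iff.2 hV] with y hy hω'
  exact hω (Set.mem_iInter₂.1 hω' V hy)

/-- Where `Λ` is almost constant, `B x y` lies up to small measure in both `Λ x` and `Λ y`, so it
gives a bad pair near `p`. Bad pairs near `p` almost force the derived event at `p`, which is almost
the one at `x`. -/
theorem IsLocallyAvoidableOff.derivedFamily [IsFiniteMeasure μ]
    (hB : ∀ x y, MeasurableSet (B x y)) {Λ : Q → Set Ω} (hc : IsClosedFamily Λ)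
    (h : IsLocallyAvoidableOff μ B Λ) : IsLocallyAvoidableOff μ B (derivedFamily B Λ) := by
  intro V hV hne η hη
  have hη4 : η / 4 ≠ 0 := (ENNReal.div_pos hη (by simp)).ne'
  have hc' := hc.derivedFamily hB
  obtain ⟨V₁, h₁V, hV₁, hne₁, hη₁⟩ := h V hV hne (η / 4) hη4
  obtain ⟨V₂, h₂₁, hV₂, hne₂, hη₂⟩ := hc.exists_isOpen_forall_measure_sdiff_le μ hV₁ hne₁ hη4
  obtain ⟨V₃, h₃₂, hV₃, ⟨p, hp⟩, hη₃⟩ :=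
    hc'.exists_isOpen_forall_measure_sdiff_le μ hV₂ hne₂ hη4
  obtain ⟨V₄, hV₄, hpV₄, hη₄⟩ := exists_isOpen_measure_sdiff_iInter_nhds_le μ
    (monotone_badPairs B Λ) (measurableSet_badPairs hB hc) p hη4
  refine ⟨V₃ ∩ V₄, Set.inter_subset_left.trans (h₃₂.trans (h₂₁.trans h₁V)), hV₃.inter hV₄,
    ⟨p, hp, hpV₄⟩, fun x hx y hy => ?_⟩
  have hsub : B x y \ _root_.derivedFamily B Λ x ⊆ (B x y \ Λ x) ∪ ((⋃ z ∈ V₂, Λ z) \ Λ y) ∪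
      (badPairs B Λ V₄ \ _root_.derivedFamily B Λ p) ∪
      ((⋃ z ∈ V₃, _root_.derivedFamily B Λ z) \ _root_.derivedFamily B Λ x) := by
    rintro ω ⟨hωB, hω⟩
    by_cases h1 : ω ∈ Λ x
    swap
    · exact Or.inl (Or.inl (Or.inl ⟨hωB, h1⟩))
    by_cases h2 : ω ∈ Λ y
    swap
    · exact Or.inl (Or.inl (Or.inr ⟨Set.mem_biUnion (h₃₂ hx.1) h1, h2⟩))
    by_cases h3 : ω ∈ _root_.derivedFamily B Λ p
    · exact Or.inr ⟨Set.mem_biUnion hp h3, hω⟩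
    · exact Or.inl (Or.inr ⟨mem_badPairs.2 ⟨x, hx.2, y, hy.2, h1, h2, hωB⟩, h3⟩)
  calc μ (B x y \ _root_.derivedFamily B Λ x) ≤ η / 4 + η / 4 + η / 4 + η / 4 := by
        refine (measure_mono hsub).trans ((measure_union_le _ _).trans ?_)
        refine add_le_add ((measure_union_le _ _).trans ?_) (hη₃ x hx.1)
        refine add_le_add ((measure_union_le _ _).trans ?_) hη₄
        exact add_le_add (hη₁ x (h₂₁ (h₃₂ hx.1)) y (h₂₁ (h₃₂ hy.1))) (hη₂ y (h₃₂ hy.1))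
    _ = η := by
        have : η / 4 + η / 4 + η / 4 + η / 4 = 4 * (η / 4) := by ring
        rw [this, ENNReal.mul_div_cancel (by norm_num) (by norm_num)]

/-- Among the closed families off which `B` is locally avoidable there is one that is almost surely
equal to its derived family. -/
theorem exists_derivedFamily_ae_eq [IsFiniteMeasure μ] (hB : ∀ x y, MeasurableSet (B x y)) :
    ∃ Λ : Q → Set Ω, IsClosedFamily Λ ∧ IsLocallyAvoidableOff μ B Λ ∧
      ∀ x, μ (Λ x \ derivedFamily B Λ x) = 0 := by
  obtain ⟨w, hw0, hw1⟩ := ENNReal.exists_pos_sum_of_countable' one_ne_zero Q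
  -- Minimizing this weighted size replaces transfinite iteration of the derivative: a minimizer
  -- loses only null sets under derivation.
  let m : (Q → Set Ω) → ℝ≥0∞ := fun Λ => ∑' x, w x * μ (Λ x)
  have hm : ∀ Λ, m Λ ≠ ∞ := fun Λ => by
    have : m Λ ≤ (∑' x, w x) * μ Set.univ := by
      rw [← ENNReal.tsum_mul_right]
      exact ENNReal.tsum_le_tsum fun x => by gcongr; exact Set.subset_univ _
    exact ne_top_of_le_ne_top (ENNReal.mul_ne_top (hw1.trans ENNReal.one_lt_top).ne
      (measure_ne_top _ _)) this
  let 𝒢 : Set (Q → Set Ω) := {Λ | IsClosedFamily Λ ∧ IsLocallyAvoidableOff μ B Λ}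
  have h𝒢 : 𝒢.Nonempty := by
    refine ⟨fun _ => Set.univ, ⟨fun _ => .univ, fun _ => by simp⟩, fun V hV hne η _ =>
      ⟨V, subset_rfl, hV, hne, fun x _ y _ => by simp⟩⟩
  obtain ⟨r, -, hr, hrm⟩ := exists_seq_tendsto_sInf (h𝒢.image m) (OrderBot.bddBelow _)
  choose Λ hΛ𝒢 hΛr using hrm
  let N : ℕ → Q → Set Ω := fun n => n.rec (Λ 0) fun k M x => M x ∩ Λ (k + 1) x
  have hN : ∀ n, N n ∈ 𝒢 := by
    intro n
    induction n with
    | zero => exact hΛ𝒢 0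
    | succ k ih => exact ⟨ih.1.inter (hΛ𝒢 (k + 1)).1, ih.2.inter (hΛ𝒢 (k + 1)).2⟩
  have hNΛ : ∀ n x, N n x ⊆ Λ n x := by
    intro n x
    cases n with
    | zero => exact subset_rfl
    | succ k => exact Set.inter_subset_right
  have hcI := IsClosedFamily.iInter fun n => (hN n).1
  have hgI := IsLocallyAvoidableOff.iInter (fun n => (hN n).1)
    (fun n x => Set.inter_subset_left) fun n => (hN n).2
  refine ⟨_, hcI, hgI, fun x => ?_⟩
  have hmin : m (fun x => ⋂ n, N n x) ≤ m (derivedFamily B fun x => ⋂ n, N n x) := by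
    refine le_trans ?_ (sInf_le (Set.mem_image_of_mem m
      (show (derivedFamily B fun x => ⋂ n, N n x) ∈ 𝒢 from ⟨hcI.derivedFamily hB, hgI.derivedFamily hB hcI⟩)))
    refine ge_of_tendsto' hr fun n => ?_
    rw [← hΛr n]
    exact ENNReal.tsum_le_tsum fun x => by
      gcongr
      exact (Set.iInter_subset _ n).trans (hNΛ n x)
  by_contra hx
  refine hmin.not_gt (ENNReal.tsum_lt_tsum (hm _) (fun y => ?_) (i := x) ?_)
  · gcongr
    exact derivedFamily_subset hcI y
  · have hwx : w x ≠ ∞ := ((ENNReal.le_tsum x).trans_lt (hw1.trans ENNReal.one_lt_top)).ne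
    refine ENNReal.mul_lt_mul_right (hw0 x).ne' hwx ?_
    rw [measure_sdiff (derivedFamily_subset hcI x)
      ((hcI.derivedFamily hB).measurableSet x).nullMeasurableSet (measure_ne_top _ _)] at hx
    exact tsub_pos_iff_lt.1 (pos_iff_ne_zero.2 hx)

/-- If for every `ω` each nonempty set of points has a relatively open nonempty piece free of
pairs at which `B` occurs, then `B` has locally small probability somewhere. -/
theorem exists_isOpen_measure_le_of_scattered [Nonempty Q] [IsFiniteMeasure μ]
    (hB : ∀ x y, MeasurableSet (B x y))
    (H : ∀ ω, ∀ D : Set Q, D.Nonempty →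
      ∃ V, IsOpen V ∧ (V ∩ D).Nonempty ∧ ∀ x ∈ V ∩ D, ∀ y ∈ V ∩ D, ω ∉ B x y)
    {η : ℝ≥0∞} (hη : η ≠ 0) :
    ∃ V : Set Q, IsOpen V ∧ V.Nonempty ∧ ∀ x ∈ V, ∀ y ∈ V, μ (B x y) ≤ η := by
  obtain ⟨Λ, hc, hg, hfix⟩ := exists_derivedFamily_ae_eq (μ := μ) hB
  have hae : ∀ᵐ ω ∂μ, ∀ x, ω ∉ Λ x := by
    have h1 : ∀ᵐ ω ∂μ, ∀ x, ω ∉ Λ x \ derivedFamily B Λ x :=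
      ae_all_iff.2 fun x => measure_eq_zero_iff_ae_notMem.1 (hfix x)
    filter_upwards [h1] with ω hω
    -- A nonempty section equal to its derivative would have bad pairs near each of its points,
    -- against `H`.
    by_contra! hne
    obtain ⟨V, hV, ⟨x, hxV, hx⟩, hVB⟩ := H ω {x | ω ∈ Λ x} hne
    have h2 : ω ∈ derivedFamily B Λ x := by
      by_contra h
      exact hω x ⟨hx, h⟩
    obtain ⟨y, hy, z, hz, hy', hz', hyz⟩ :=
      mem_badPairs.1 (Set.mem_iInter₂.1 h2 V (hV.mem_nhds hxV))
    exact hVB y ⟨hy, hy'⟩ z ⟨hz, hz'⟩ hyz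
  obtain ⟨V, -, hV, hne, hVη⟩ := hg Set.univ isOpen_univ Set.univ_nonempty η hη
  refine ⟨V, hV, hne, fun x hx y hy => le_trans ?_ (hVη x hx y hy)⟩
  refine measure_mono_ae ?_
  filter_upwards [hae] with ω hω hωB
  exact ⟨hωB, hω x⟩

end RandomClosedSets

/-! ### Baire class one families and Rosenthal compacta -/

/-- A Baire class one function has small oscillation on a relatively open nonempty piece of each
nonempty set. -/
theorem IsBaireClassOne.exists_isOpen_oscillation_lt {P : Type v} [TopologicalSpace P]
    [PolishSpace P] {f : P → ℝ} (hf : IsBaireClassOne f) {D : Set P} (hD : D.Nonempty) {ε : ℝ}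
    (hε : 0 < ε) :
    ∃ V, IsOpen V ∧ (V ∩ D).Nonempty ∧ ∀ x ∈ V ∩ D, ∀ y ∈ V ∩ D, |f x - f y| < ε := by
  obtain ⟨g, hg⟩ := hf
  have : PolishSpace (closure D) := isClosed_closure.polishSpace
  have : Nonempty (closure D) := hD.closure.to_subtype
  -- Baire category in `closure D` gives an open piece on which `g N` is uniformly close to `f`.
  -- Four errors of `ε / 5` then separate `f x` from `f y`.
  let A : ℕ → Set (closure D) := fun N => ⋂ n ≥ N, ⋂ m ≥ N, {x | |g n x - g m x| ≤ ε / 5}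
  have hA : ∀ N, IsClosed (A N) := fun N =>
    isClosed_biInter fun n _ => isClosed_biInter fun m _ =>
      isClosed_le (by fun_prop) continuous_const
  have hAU : ⋃ N, A N = Set.univ := by
    refine Set.eq_univ_of_forall fun x => ?_
    obtain ⟨N, hN⟩ := Metric.cauchySeq_iff.1 (hg x).cauchySeq (ε / 5) (by positivity)
    exact Set.mem_iUnion.2 ⟨N, Set.mem_iInter₂.2 fun n hn => Set.mem_iInter₂.2 fun m hm =>
      (hN n hn m hm).le⟩
  obtain ⟨N, p, hp⟩ := nonempty_interior_of_iUnion_of_closed hA hAU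
  have hfg : ∀ x ∈ A N, |g N x - f x| ≤ ε / 5 := fun x hx =>
    le_of_tendsto ((tendsto_const_nhds.sub (hg x)).abs) (by
      filter_upwards [eventually_ge_atTop N] with m hm
      exact Set.mem_iInter₂.1 (Set.mem_iInter₂.1 hx N le_rfl) m hm)
  have hU : IsOpen (interior (A N) ∩ {x | |g N x - g N p| < ε / 5}) :=
    isOpen_interior.inter (isOpen_lt (by fun_prop) continuous_const)
  obtain ⟨V, hV, hVU⟩ := isOpen_induced_iff.1 hU
  have hmem : ∀ x : closure D, (x : P) ∈ V →
      x ∈ interior (A N) ∩ {x | |g N x - g N p| < ε / 5} := fun x hx => by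
    rw [← hVU]; exact hx
  have hpV : (p : P) ∈ V := by
    have : p ∈ Subtype.val ⁻¹' V := by
      rw [hVU]
      exact ⟨hp, by simpa using by positivity⟩
    exact this
  refine ⟨V, hV, mem_closure_iff.1 p.2 V hV hpV, ?_⟩
  rintro x ⟨hxV, hxD⟩ y ⟨hyV, hyD⟩
  obtain ⟨hx1, hx2⟩ := hmem ⟨x, subset_closure hxD⟩ hxV
  obtain ⟨hy1, hy2⟩ := hmem ⟨y, subset_closure hyD⟩ hyV
  have hx3 := hfg _ (interior_subset hx1)
  have hy3 := hfg _ (interior_subset hy1)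
  simp only [Set.mem_ofPred_eq] at hx2 hy2
  rw [abs_lt] at hx2 hy2
  rw [abs_le] at hx3 hy3
  rw [abs_lt]
  constructor <;> linarith [hx2.1, hx2.2, hy2.1, hy2.2, hx3.1, hx3.2, hy3.1, hy3.2]

section BaireOneFamilies

open scoped ENNReal

variable {K : Type*} [TopologicalSpace K] [CompactSpace K]

/-- A countable family of continuous functions on a compact space is determined by its values on
the closure of a countable set. -/
theorem exists_countable_forall_exists_closure_eq {E : Type*} [Countable E] (Φ : E → C(K, ℝ)) :
    ∃ D : Set K, D.Countable ∧ ∃ s : K → K, (∀ x, s x ∈ closure D) ∧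
      ∀ e x, Φ e (s x) = Φ e x := by
  let π : K → E → ℝ := fun x e => Φ e x
  have hπ : Continuous π := by fun_prop
  obtain ⟨t, htπ, htc, htd⟩ :=
    (TopologicalSpace.IsSeparable.of_separableSpace (Set.range π)).exists_countable_dense_subset
  have := htc.to_subtype
  choose σ hσ using fun y : t => htπ y.2
  -- A compact image is closed, so it contains the closure of `t` and hence all of `range π`.
  have hclosed : IsClosed (π '' closure (Set.range σ)) :=
    (isClosed_closure.isCompact.image hπ).isClosed
  have hsub : closure t ⊆ π '' closure (Set.range σ) :=
    closure_minimal (fun y hy => ⟨σ ⟨y, hy⟩, subset_closure ⟨_, rfl⟩, hσ ⟨y, hy⟩⟩) hclosed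
  choose s hs hsπ using fun x => hsub (htd ⟨x, rfl⟩)
  exact ⟨Set.range σ, Set.countable_range σ, s, hs, fun e x => congrFun (hsπ x) e⟩

variable [MeasurableSpace K] [BorelSpace K] {Z : Type*} [TopologicalSpace Z] [PolishSpace Z]

/-- For a family of continuous functions parametrized in a Baire class one way by a Polish space,
some countable set meets the supports of all members that are large in measure. -/
theorem exists_countable_forall_measure_lt (μ : Measure K) [IsFiniteMeasure μ]
    (Φ : Z → C(K, ℝ)) (hΦ : ∀ x, IsBaireClassOne fun z => Φ z x) {ε : ℝ} (hε : 0 < ε) {η : ℝ≥0∞}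
    (hη : η ≠ 0) :
    ∃ D : Set K, D.Countable ∧ ∀ z, (∀ x ∈ D, Φ z x = 0) → μ {x | ε ≤ Φ z x} < η := by
  by_contra! hcon
  let G : Set K → Set Z := fun D => {z | (∀ x ∈ D, Φ z x = 0) ∧ η ≤ μ {x | ε ≤ Φ z x}}
  have hG : ∀ {D D'}, D ⊆ D' → G D' ⊆ G D := fun h z hz => ⟨fun x hx => hz.1 x (h hx), hz.2⟩
  have hGne : ∀ D, D.Countable → (G D).Nonempty := hcon
  -- The closures of `G D` decrease with `D`; as `Z` has a countable base, they stabilize at a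
  -- countable `D₀`.
  have hst : ∃ D₀ : Set K, D₀.Countable ∧
      ∀ D, D.Countable → D₀ ⊆ D → G D₀ ⊆ closure (G D) := by
    have h1 : ∀ V : Set Z, ∃ D : Set K, D.Countable ∧
        ∀ D', D'.Countable → Disjoint V (G D') → Disjoint V (G D) := by
      intro V
      by_cases h : ∃ D' : Set K, D'.Countable ∧ Disjoint V (G D')
      · obtain ⟨D', hD', hV⟩ := h
        exact ⟨D', hD', fun _ _ _ => hV⟩
      · exact ⟨∅, Set.countable_empty, fun D' hD' hV => (h ⟨D', hD', hV⟩).elim⟩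
    choose D hDc hD using h1
    refine ⟨⋃ V ∈ TopologicalSpace.countableBasis Z, D V,
      (TopologicalSpace.countable_countableBasis Z).biUnion fun V _ => hDc V, ?_⟩
    intro D' hD' hsub z hz
    rw [(TopologicalSpace.isBasis_countableBasis Z).mem_closure_iff]
    intro V hV hzV
    rw [← Set.not_disjoint_iff_nonempty_inter]
    intro hdisj
    exact Set.disjoint_left.1 (hD V D' hD' hdisj) hzV (hG (Set.subset_biUnion_of_mem hV) hz)
  obtain ⟨D₀, hD₀, hD₀G⟩ := hst
  obtain ⟨E, hEG, hEc, hEd⟩ :=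
    (TopologicalSpace.IsSeparable.of_separableSpace (G D₀)).exists_countable_dense_subset
  have := hEc.to_subtype
  obtain ⟨D, hD, s, hs, hsE⟩ := exists_countable_forall_exists_closure_eq fun z : E => Φ z
  obtain ⟨E', hEG', hEc', hEd'⟩ :=
    (TopologicalSpace.IsSeparable.of_separableSpace (G (D₀ ∪ D))).exists_countable_dense_subset
  have hs0 : ∀ z ∈ E', ∀ x, Φ z (s x) = 0 := fun z hz x => by
    have hcl : IsClosed {x | Φ z x = 0} := isClosed_eq (by fun_prop) continuous_const
    exact closure_minimal (fun x hx => (hEG' hz).1 x (Or.inr hx)) hcl (hs x)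
  have := (hEc.union hEc').to_subtype
  have hne : Nonempty (E ∪ E' : Set Z) := by
    obtain ⟨z, hz⟩ := closure_nonempty_iff.1 ((hGne D₀ hD₀).mono hEd)
    exact ⟨z, Or.inl hz⟩
  -- Composition with `s` fixes the functions from `E` and kills those from `E'`, so `B` is
  -- measurable although `s` need not be.
  let B : (E ∪ E' : Set Z) → (E ∪ E' : Set Z) → Set K := fun z w =>
    {x | ε ≤ |Φ z (s x) - Φ w (s x)|}
  have hmeas : ∀ z : (E ∪ E' : Set Z), Measurable fun x => Φ z (s x) := by
    rintro ⟨z, hz | hz⟩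
    · simp only [fun x => hsE ⟨z, hz⟩ x]
      exact (Φ z).continuous.measurable
    · simp only [hs0 z hz]
      exact measurable_const
  obtain ⟨V, hV, ⟨v, hv⟩, hVη⟩ := exists_isOpen_measure_le_of_scattered (μ := μ) (B := B)
    (fun z w => measurableSet_le measurable_const ((hmeas z).sub (hmeas w)).abs) (by
      intro x A hA
      obtain ⟨U, hU, ⟨_, hzU, z, hz, rfl⟩, hosc⟩ :=
        (hΦ (s x)).exists_isOpen_oscillation_lt (hA.image Subtype.val) hε
      refine ⟨Subtype.val ⁻¹' U, hU.preimage continuous_subtype_val, ⟨z, hzU, hz⟩, ?_⟩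
      rintro y ⟨hyU, hy⟩ w ⟨hwU, hw⟩ hyw
      exact (hosc y ⟨hyU, y, hy, rfl⟩ w ⟨hwU, w, hw, rfl⟩).not_ge hyw)
    (ENNReal.half_pos hη).ne'
  obtain ⟨U, hU, rfl⟩ := isOpen_induced_iff.1 hV
  have hvE : (v : Z) ∈ closure E := by
    rcases v.2 with h | h
    · exact subset_closure h
    · exact hEd (hG Set.subset_union_left (hEG' h))
  obtain ⟨z, hzU, hz⟩ := mem_closure_iff.1 hvE U hU hv
  have hzE' : z ∈ closure E' :=
    closure_minimal hEd' isClosed_closure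
      (hD₀G _ (hD₀.union hD) Set.subset_union_left (hEG hz))
  obtain ⟨w, hwU, hw⟩ := mem_closure_iff.1 hzE' U hU hzU
  have hle := hVη ⟨z, Or.inl hz⟩ hzU ⟨w, Or.inr hw⟩ hwU
  have hge : η ≤ μ (B ⟨z, Or.inl hz⟩ ⟨w, Or.inr hw⟩) := by
    refine (hEG hz).2.trans (measure_mono fun x hx => ?_)
    change ε ≤ |Φ z (s x) - Φ w (s x)|
    rw [hs0 w hw, sub_zero, hsE ⟨z, hz⟩ x]
    exact hx.trans (le_abs_self _)
  exact (hge.trans hle).not_gt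
    (ENNReal.half_lt_self hη (ne_top_of_le_ne_top (measure_ne_top μ _) hge))

end BaireOneFamilies

/-- If countably many such families separate points from closed sets, then regular measures are
carried by separable closed sets. -/
theorem regularMeasuresSeparablyCarried_of_families {K : Type*} [TopologicalSpace K]
    [CompactSpace K] [MeasurableSpace K] [BorelSpace K] {ι : Type*} [Countable ι] {Z : ι → Type*}
    [∀ i, TopologicalSpace (Z i)] [∀ i, PolishSpace (Z i)] (Φ : ∀ i, Z i → C(K, ℝ))
    (hΦ : ∀ i x, IsBaireClassOne fun z => Φ i z x)
    (hsep : ∀ C : Set K, IsClosed C → ∀ x ∉ C, ∃ i z, (∀ y ∈ C, Φ i z y = 0) ∧ 0 < Φ i z x) :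
    RegularMeasuresSeparablyCarried K := by
  intro μ hfin hreg
  -- Thresholds `1 / (m + 1)` and `1 / n`; for `n = 0` the latter is `∞`, which is harmless.
  choose D hDc hD using fun (i : ι) (m n : ℕ) => exists_countable_forall_measure_lt μ (Φ i) (hΦ i)
    (Nat.one_div_pos_of_nat (α := ℝ) (n := m)) (ENNReal.inv_ne_zero.2 (ENNReal.natCast_ne_top n))
  refine ⟨⋃ i, ⋃ m, ⋃ n, D i m n, Set.countable_iUnion fun i =>
    Set.countable_iUnion fun m => Set.countable_iUnion fun n => hDc i m n,
    measure_mono_null (Set.compl_subset_compl.2 fun x hx => ?_)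
      μ.measure_compl_support_of_regular⟩
  by_contra hxD
  obtain ⟨i, z, hz, hzx⟩ := hsep _ isClosed_closure x hxD
  have hpos : 0 < μ {y | 0 < Φ i z y} := (Measure.mem_support_iff_forall x).1 hx _
    ((isOpen_lt continuous_const (by fun_prop)).mem_nhds hzx)
  have hU : {y | 0 < Φ i z y} ⊆ ⋃ m : ℕ, {y | 1 / ((m : ℝ) + 1) ≤ Φ i z y} := fun y hy => by
    obtain ⟨m, hm⟩ := exists_nat_one_div_lt (show 0 < Φ i z y from hy)
    exact Set.mem_iUnion.2 ⟨m, hm.le⟩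
  obtain ⟨m, hm⟩ := exists_measure_pos_of_not_measure_iUnion_null
    (hpos.trans_le (measure_mono hU)).ne'
  obtain ⟨n, hn⟩ := ENNReal.exists_inv_nat_lt hm.ne'
  exact (hD i m n z fun y hy => hz y (subset_closure
    (Set.mem_iUnion.2 ⟨i, Set.mem_iUnion.2 ⟨m, Set.mem_iUnion.2 ⟨n, hy⟩⟩⟩))).not_gt hn

/-- Regular measures on Rosenthal compacta are carried by separable closed sets. -/
theorem IsRosenthalCompactum.regularMeasuresSeparablyCarried {K : Type u} [TopologicalSpace K]
    [CompactSpace K] [MeasurableSpace K] [BorelSpace K] (hK : IsRosenthalCompactum.{u, v} K) :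
    RegularMeasuresSeparablyCarried K := by
  obtain ⟨P, _, _, S, -, hS, ⟨h⟩⟩ := hK
  let ev : K → P → ℝ := fun x => (h x : P → ℝ)
  have hev : Continuous ev := continuous_subtype_val.comp h.continuous
  have hevp : ∀ p, Continuous fun x => ev x p := fun p => (continuous_apply p).comp hev
  -- Bumps over basic neighborhoods of the pointwise topology; the parameter lists the test points,
  -- the target values and the radius.
  let Φ : ∀ k : ℕ, (Fin k → P × ℝ) × ℝ → C(K, ℝ) := fun k z =>
    ⟨fun x => max 0 (z.2 - ∑ j, |ev x (z.1 j).1 - (z.1 j).2|), by fun_prop⟩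
  refine regularMeasuresSeparablyCarried_of_families Φ (fun k x => ?_) fun C hC x hx => ?_
  · obtain ⟨g, hg⟩ := hS _ (h x).2
    refine ⟨fun n => ⟨fun z => max 0 (z.2 - ∑ j, |g n (z.1 j).1 - (z.1 j).2|), by fun_prop⟩,
      fun z => ?_⟩
    exact tendsto_const_nhds.max (tendsto_const_nhds.sub
      (tendsto_finsetSum _ fun j _ => ((hg _).sub tendsto_const_nhds).abs))
  · have hemb : IsEmbedding ev := IsEmbedding.subtypeVal.comp h.isEmbedding
    obtain ⟨W, hW, hWC⟩ := hemb.isInducing.isOpen_iff.1 hC.isOpen_compl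
    have hxW : ev x ∈ W := by
      have : x ∈ ev ⁻¹' W := by rw [hWC]; exact hx
      exact this
    obtain ⟨I, u, hu, hIW⟩ := isOpen_pi_iff.1 hW _ hxW
    have hr : ∃ r > 0, ∀ p ∈ I, Metric.ball (ev x p) r ⊆ u p := by
      have : ∀ᶠ r in 𝓝[>] (0 : ℝ), ∀ p ∈ I, Metric.ball (ev x p) r ⊆ u p := by
        refine (Filter.eventually_all_finset I).2 fun p hp => ?_
        obtain ⟨δ, hδ, hδu⟩ := Metric.isOpen_iff.1 (hu p hp).1 _ (hu p hp).2
        filter_upwards [Ioc_mem_nhdsGT hδ] with r hr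
        exact (Metric.ball_subset_ball hr.2).trans hδu
      obtain ⟨r, hr, hr0⟩ := (this.and self_mem_nhdsWithin).exists
      exact ⟨r, hr0, hr⟩
    obtain ⟨r, hr0, hr⟩ := hr
    let p : Fin I.card → P := fun j => (I.equivFin.symm j : P)
    refine ⟨I.card, (fun j => (p j, ev x (p j)), r), fun y hy => ?_, ?_⟩
    · change max 0 (r - ∑ j, |ev y (p j) - ev x (p j)|) = 0
      refine max_eq_left (sub_nonpos.2 (not_lt.1 fun hlt => ?_))
      have hyW : ev y ∈ W := hIW fun q hq => hr q hq (by
        rw [Metric.mem_ball, Real.dist_eq]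
        have hpj : p (I.equivFin ⟨q, hq⟩) = q := by simp [p]
        have := Finset.single_le_sum (f := fun j => |ev y (p j) - ev x (p j)|)
          (fun j _ => abs_nonneg _) (Finset.mem_univ (I.equivFin ⟨q, hq⟩))
        simp only [hpj] at this
        exact this.trans_lt hlt)
      have : y ∈ ev ⁻¹' W := hyW
      rw [hWC] at this
      exact this hy
    · change 0 < max 0 (r - ∑ j, |ev x (p j) - ev x (p j)|)
      simpa using hr0

/-! ### Conclusion -/

theorem theorem3p2 :
    (∀ (K : Type u) [TopologicalSpace K] [CompactSpace K] [T2Space K] [MeasurableSpace K]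
      [BorelSpace K], IsMonolithic K → HasPropertyM K → HasC0ExtensionProperty 2 C(K, ℝ)) ∧
    (∀ (K : Type u) [LinearOrder K] [TopologicalSpace K] [OrderTopology K] [CompactSpace K],
      IsMonolithic K → HasC0ExtensionProperty 2 C(K, ℝ)) ∧
    (∀ (K : Type u) [TopologicalSpace K] [CompactSpace K] [T2Space K],
      IsMonolithic K → IsScatteredSpace K → HasC0ExtensionProperty 2 C(K, ℝ)) ∧
    (∀ (K : Type u) [TopologicalSpace K] [CompactSpace K] [T2Space K],
      IsMonolithic K → IsRosenthalCompactum.{u, v} K → HasC0ExtensionProperty 2 C(K, ℝ)) := by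
  refine ⟨fun K _ _ _ _ _ hK hM =>
    hK.hasC0ExtensionProperty hM.regularMeasuresSeparablyCarried,
    fun K _ _ _ _ hK => ?_, fun K _ _ _ hK hS => ?_, fun K _ _ _ hK hR => ?_⟩ <;>
  let _ : MeasurableSpace K := borel K <;>
  have _ : BorelSpace K := ⟨rfl⟩
  · exact hK.hasC0ExtensionProperty regularMeasuresSeparablyCarried_of_linearOrder
  · exact hK.hasC0ExtensionProperty hS.regularMeasuresSeparablyCarried
  · exact hK.hasC0ExtensionProperty hR.regularMeasuresSeparablyCarried
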